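/- For an integer $k\ge 0$ let $D_k>0$ be the generalized Glaisher (Bendersky–Adamchik) constant, defined by $$\log D_k=\lim_{n\to\infty}\Big(\sum_{j=1}^{n}j^k\log j-p(n,k)\Big),$$ $$p(n,k)=\frac{n^k\log n}{2}+\frac{n^{k+1}}{k+1}\Big(\log n-\frac1{k+1}\Big)+k!\sum_{j=1}^{k}\frac{n^{k-j}B_{j+1}}{(j+1)!\,(k-j)!}\Big(\log n+(1-\delta_{kj})\sum_{l=1}^{j}\frac1{k-l+1}\Big),$$ where $B_j$ are the Bernoulli numbers and $\delta_{kj}$ is the Kronecker delta; these limits exist. For $\mathrm{Re}(\alpha)>0$ and $x>a$ let $$I_{a^+}^{\alpha}f(x)=\frac1{\Gamma(\alpha)}\int_a^x(x-t)^{\alpha-1}f(t)\,dt$$ be the left-sided Riemann–Liouville fractional integral. Then for every integer $m\ge 1$, $$I_{0^+}^{m}\log\Gamma(1)=\int_0^1dt_1\int_0^{t_1}dt_2\cdots\int_0^{t_{m-1}}dt_m\,\log\Gamma(t_m)=\frac1{m!}\sum_{k=0}^{m-1}\binom mk\log D_k=\sum_{k=0}^{m-1}\frac{\log D_k}{k!\,(m-k)!},$$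 where all the integrals converge absolutely. -/

import Mathlib

/-- The correction term `p(n,k)` in the definition of the generalized Glaisher constants,
`n^k log n / 2 + n^(k+1)/(k+1) (log n - 1/(k+1))
  + k! ∑_{m=1}^k n^(k-m) B_{m+1} / ((m+1)! (k-m)!) (log n + (1-δ_{km}) ∑_{l=1}^m 1/(k-l+1))`. -/
noncomputable def glaisherCorrection (n k : ℕ) : ℝ :=
  (n : ℝ) ^ k * Real.log n / 2
    + (n : ℝ) ^ (k + 1) / ((k : ℝ) + 1) * (Real.log n - 1 / ((k : ℝ) + 1))
    + (k.factorial : ℝ) * ∑ m ∈ Finset.Icc 1 k,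
        (n : ℝ) ^ (k - m) * (bernoulli (m + 1) : ℝ)
          / (((m + 1).factorial : ℝ) * ((k - m).factorial : ℝ))
        * (Real.log n
            + (1 - if k = m then (1 : ℝ) else 0)
              * ∑ l ∈ Finset.Icc 1 m, 1 / ((k : ℝ) - (l : ℝ) + 1))

/-- The sequence `n ↦ ∑_{m=1}^n m^k log m - p(n,k)`, whose limit is `log D_k`. -/
noncomputable def glaisherSeq (k n : ℕ) : ℝ :=
  (∑ m ∈ Finset.Icc 1 n, (m : ℝ) ^ k * Real.log m) - glaisherCorrection n k

/-- The generalized Glaisher (Bendersky–Adamchik) constant `D_k`, given by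
`log D_k = lim_{n → ∞} (∑_{m=1}^n m^k log m - p(n,k))`. -/
noncomputable def generalizedGlaisher (k : ℕ) : ℝ :=
  Real.exp (Filter.limUnder Filter.atTop (glaisherSeq k))

/-- The left-sided Riemann–Liouville fractional integral of complex order `α` (`0 < re α`),
`I_{a⁺}^α f(x) = 1/Γ(α) ∫_a^x (x-t)^(α-1) f(t) dt`. -/
noncomputable def leftRiemannLiouville (a : ℝ) (α : ℂ) (f : ℝ → ℝ) (x : ℝ) : ℂ :=
  1 / Complex.Gamma α * ∫ t in a..x, ((x - t : ℝ) : ℂ) ^ (α - 1) * ((f t : ℝ) : ℂ)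

/-- The `n`-fold repeated integral
`∫_a^x dt₁ ∫_a^{t₁} dt₂ … ∫_a^{t_{n-1}} f(t_n) dt_n` (equal to `f x` for `n = 0`). -/
noncomputable def repeatedIntegral (a : ℝ) (f : ℝ → ℝ) : ℕ → ℝ → ℝ
  | 0, x => f x
  | n + 1, x => ∫ t in a..x, repeatedIntegral a f n t

/-- The function `x ↦ log Γ(x)`. -/
noncomputable def logGamma (x : ℝ) : ℝ := Real.log (Real.Gamma x)

/-! ### Sequences polynomial in n with a logarithm, and their limits. -/

open Filter Topology

/-! Cauchy's formula turns the `m`-fold integral into a moment `∫₀¹ (1 - t)^(m-1) log Γ(t) dt`, up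
to `1/(m-1)!`. On `(0, 1]`, `log Γ` is a uniform limit of Euler's sequence `t log n + log n! - ∑_{j
≤ n} log (t + j)`, whose moments are elementary. Summation by parts and the binomial theorem turn
them into `∑_k (m choose k) ∑_j j^k log j` plus explicit terms.

Replacing the inner sums by `glaisherSeq` plus `glaisherCorrection` leaves a remainder `A(N) + B(N)
log N`, with `A`, `B` polynomials and `A(0) = 0`. The remainder converges because everything else
does, and such a sequence can only converge to `A(0)` (`IsPolyLog.limit_eq_zero`). Hence the
cancellation of Bernoulli terms is never computed.

That `glaisherSeq` converges is Euler–Maclaurin: the one-step error is `O(1/n²)`, hence summable. -/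

lemma eq_of_tendsto_add_mul_log {a b L : ℝ}
    (h : Tendsto (fun n : ℕ => a + b * Real.log n) atTop (𝓝 L)) : b = 0 ∧ L = a := by
  have hlog : Tendsto (fun n : ℕ => Real.log (n : ℝ)) atTop atTop :=
    Real.tendsto_log_atTop.comp tendsto_natCast_atTop_atTop
  have hb : b = 0 := by
    by_contra hb
    have h2 : Tendsto (fun n : ℕ => Real.log (n : ℝ)) atTop (𝓝 ((L - a) / b)) := by
      refine ((h.sub_const a).div_const b).congr fun n => ?_
      field_simp
      ring
    exact not_tendsto_nhds_of_tendsto_atTop hlog _ h2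
  subst hb
  refine ⟨rfl, ?_⟩
  simp only [zero_mul, add_zero] at h
  exact tendsto_nhds_unique h tendsto_const_nhds

lemma tendsto_log_div_natCast_pow {d : ℕ} (hd : 1 ≤ d) :
    Tendsto (fun n : ℕ => Real.log n / (n : ℝ) ^ d) atTop (𝓝 0) := by
  have h := (isLittleO_log_rpow_atTop (r := (d : ℝ)) (by exact_mod_cast hd)).tendsto_div_nhds_zero
  refine (h.comp tendsto_natCast_atTop_atTop).congr fun n => ?_
  simp

lemma tendsto_inv_natCast_pow {d : ℕ} (hd : 1 ≤ d) :
    Tendsto (fun n : ℕ => 1 / (n : ℝ) ^ d) atTop (𝓝 0) := by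
  have h := tendsto_pow_neg_atTop (𝕜 := ℝ) (n := d) (by omega)
  refine (h.comp tendsto_natCast_atTop_atTop).congr fun n => ?_
  simp [zpow_neg]

/-- A convergent sequence of the form `∑ (aᵢ + bᵢ log n) nⁱ` converges to `a₀`. -/
lemma limit_eq_of_tendsto_sum_log (a b : ℕ → ℝ) (d : ℕ) {L : ℝ}
    (h : Tendsto (fun n : ℕ => ∑ i ∈ Finset.range (d + 1), (a i + b i * Real.log n) * (n : ℝ) ^ i)
      atTop (𝓝 L)) : L = a 0 := by
  induction d with
  | zero => exact (eq_of_tendsto_add_mul_log (by simpa using h)).2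
  | succ d ih =>
    have hlow : Tendsto (fun n : ℕ => (∑ i ∈ Finset.range (d + 1),
        (a i + b i * Real.log n) * (n : ℝ) ^ i) / (n : ℝ) ^ (d + 1)) atTop (𝓝 0) := by
      have : Tendsto (fun n : ℕ => ∑ i ∈ Finset.range (d + 1),
          (a i * (1 / (n : ℝ) ^ (d + 1 - i)) + b i * (Real.log n / (n : ℝ) ^ (d + 1 - i))))
          atTop (𝓝 (∑ i ∈ Finset.range (d + 1), (a i * 0 + b i * 0))) := by
        refine tendsto_finsetSum _ fun i hi => ?_
        have hi' : 1 ≤ d + 1 - i := by have := Finset.mem_range.1 hi; omega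
        exact ((tendsto_inv_natCast_pow hi').const_mul _).add
          ((tendsto_log_div_natCast_pow hi').const_mul _)
      simp only [mul_zero, add_zero, Finset.sum_const_zero] at this
      refine this.congr' ?_
      filter_upwards [eventually_gt_atTop 0] with n hn
      rw [Finset.sum_div]
      refine Finset.sum_congr rfl fun i hi => ?_
      have hn' : (n : ℝ) ≠ 0 := by positivity
      have hp : (n : ℝ) ^ (d + 1) = (n : ℝ) ^ i * (n : ℝ) ^ (d + 1 - i) := by
        rw [← pow_add]; congr 1; have := Finset.mem_range.1 hi; omega
      rw [hp]
      field_simp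
    -- Divided by `n^(d+1)`, the convergent sum and its lower terms tend to 0; so does the top
    -- coefficient, whose two parts then vanish.
    have htop : Tendsto (fun n : ℕ => a (d + 1) + b (d + 1) * Real.log n) atTop (𝓝 0) := by
      have h1 := h.mul (tendsto_inv_natCast_pow (d := d + 1) (by omega))
      have h2 := h1.sub hlow
      simp only [mul_zero, sub_zero] at h2
      refine h2.congr' ?_
      filter_upwards [eventually_gt_atTop 0] with n hn
      have hn' : (n : ℝ) ≠ 0 := by positivity
      rw [Finset.sum_range_succ]
      generalize ∑ i ∈ Finset.range (d + 1), (a i + b i * Real.log n) * (n : ℝ) ^ i = s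
      field_simp
      ring
    obtain ⟨hb, ha⟩ := eq_of_tendsto_add_mul_log htop
    apply ih
    refine h.congr fun n => ?_
    rw [Finset.sum_range_succ, hb, ← ha]
    simp

/-- Sequences `A(n) + B(n) log n` with polynomials `A`, `B` and `A(0) = 0`. -/
def IsPolyLog (f : ℕ → ℝ) : Prop :=
  ∃ A B : Polynomial ℝ, A.eval 0 = 0 ∧ ∀ n : ℕ, f n = A.eval (n : ℝ) + B.eval (n : ℝ) * Real.log n

namespace IsPolyLog

lemma add {f g : ℕ → ℝ} (hf : IsPolyLog f) (hg : IsPolyLog g) :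
    IsPolyLog (fun n => f n + g n) := by
  obtain ⟨A, B, h0, h⟩ := hf
  obtain ⟨A', B', h0', h'⟩ := hg
  exact ⟨A + A', B + B', by simp [h0, h0'], fun n => by simp [h, h']; ring⟩

lemma const_mul {f : ℕ → ℝ} (c : ℝ) (hf : IsPolyLog f) : IsPolyLog (fun n => c * f n) := by
  obtain ⟨A, B, h0, h⟩ := hf
  exact ⟨Polynomial.C c * A, Polynomial.C c * B, by simp [h0], fun n => by simp [h]; ring⟩

lemma sub {f g : ℕ → ℝ} (hf : IsPolyLog f) (hg : IsPolyLog g) :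
    IsPolyLog (fun n => f n - g n) := by
  simpa [sub_eq_add_neg] using hf.add (hg.const_mul (-1))

lemma sum {ι : Type*} (s : Finset ι) {f : ι → ℕ → ℝ} (hf : ∀ i ∈ s, IsPolyLog (f i)) :
    IsPolyLog (fun n => ∑ i ∈ s, f i n) := by
  classical
  induction s using Finset.induction_on with
  | empty => exact ⟨0, 0, by simp, by simp⟩
  | insert i s hi ih =>
    simp only [Finset.sum_insert hi]
    exact (hf i (by simp)).add (ih fun j hj => hf j (by simp [hj]))

lemma pow {i : ℕ} (hi : i ≠ 0) : IsPolyLog (fun n => (n : ℝ) ^ i) :=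
  ⟨Polynomial.X ^ i, 0, by simp [hi], by simp⟩

lemma pow_mul_log (i : ℕ) : IsPolyLog (fun n => (n : ℝ) ^ i * Real.log n) :=
  ⟨0, Polynomial.X ^ i, by simp, by simp⟩

/-- Faulhaber's polynomial has no constant term: its exponents `p + 1 - i` are all positive. -/
lemma sum_pow (p : ℕ) : IsPolyLog (fun n => ∑ j ∈ Finset.range n, ((j : ℝ) + 1) ^ p) := by
  have h : ∀ n : ℕ, ∑ j ∈ Finset.range n, ((j : ℝ) + 1) ^ p =
      ∑ i ∈ Finset.range (p + 1),
        ((bernoulli' i : ℝ) * (p + 1).choose i / (p + 1)) * (n : ℝ) ^ (p + 1 - i) := by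
    intro n
    have h1 := congrArg (fun q : ℚ => (q : ℝ)) (sum_Ico_pow n p)
    rw [Finset.sum_Ico_eq_sum_range] at h1
    push_cast at h1
    rw [Finset.sum_congr rfl fun j _ => by rw [add_comm (j : ℝ) 1], h1]
    exact Finset.sum_congr rfl fun i _ => by ring
  simp only [h]
  refine sum _ fun i hi => (pow ?_).const_mul _
  have := Finset.mem_range.1 hi
  omega

lemma limit_eq_zero {f : ℕ → ℝ} (hf : IsPolyLog f) {L : ℝ} (h : Tendsto f atTop (𝓝 L)) :
    L = 0 := by
  obtain ⟨A, B, h0, hf⟩ := hf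
  rw [← h0, ← Polynomial.coeff_zero_eq_eval_zero]
  refine limit_eq_of_tendsto_sum_log A.coeff B.coeff (max A.natDegree B.natDegree) ?_
  refine h.congr fun n => ?_
  rw [hf, A.eval_eq_sum_range' (Nat.lt_succ_of_le (le_max_left A.natDegree B.natDegree)),
    B.eval_eq_sum_range' (Nat.lt_succ_of_le (le_max_right A.natDegree B.natDegree)),
    Finset.sum_mul, ← Finset.sum_add_distrib]
  exact Finset.sum_congr rfl fun i _ => by ring

end IsPolyLog

/-- The factor `1 - δ` removes the only possible constant term, at `j = k`; this normalization is
why the final formula carries no additive constant. -/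
lemma isPolyLog_glaisherCorrection (k : ℕ) : IsPolyLog (fun n => glaisherCorrection n k) := by
  unfold glaisherCorrection
  refine (IsPolyLog.add ?_ ?_).add (IsPolyLog.const_mul _ (IsPolyLog.sum _ fun j hj => ?_))
  · convert (IsPolyLog.pow_mul_log k).const_mul (1 / 2) using 2
    ring
  · convert ((IsPolyLog.pow_mul_log (k + 1)).const_mul (1 / ((k : ℝ) + 1))).sub
      ((IsPolyLog.pow (i := k + 1) (by omega)).const_mul (1 / ((k : ℝ) + 1) ^ 2)) using 2
    have : (k : ℝ) + 1 ≠ 0 := by positivity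
    field_simp
  · set c := (bernoulli (j + 1) : ℝ) / (((j + 1).factorial : ℝ) * ((k - j).factorial : ℝ)) with hc
    by_cases hkj : k = j
    · convert (IsPolyLog.pow_mul_log (k - j)).const_mul c using 2
      simp [hkj, hc]
    · have hj' := Finset.mem_Icc.1 hj
      convert ((IsPolyLog.pow_mul_log (k - j)).const_mul c).add
        ((IsPolyLog.pow (i := k - j) (by omega)).const_mul
          (c * ∑ l ∈ Finset.Icc 1 j, 1 / ((k : ℝ) - (l : ℝ) + 1))) using 2
      simp only [hkj, if_false, hc]
      ring

/-! ### Euler–Maclaurin summation and existence of the Glaisher constants. -/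

/-- A primitive of `x ^ k * log x` (index `0`) followed by the successive derivatives of
`x ^ k * log x`, up to order `k + 2`. -/
noncomputable def powLogDeriv (k : ℕ) : ℕ → ℝ → ℝ
  | 0, x => x ^ (k + 1) / ((k : ℝ) + 1) * (Real.log x - 1 / ((k : ℝ) + 1))
  | j + 1, x =>
    if j ≤ k then (k.factorial : ℝ) / ((k - j).factorial : ℝ) * x ^ (k - j)
      * (Real.log x + ∑ l ∈ Finset.Icc 1 j, 1 / ((k : ℝ) - (l : ℝ) + 1))
    else if j = k + 1 then (k.factorial : ℝ) / x
    else -(k.factorial : ℝ) / x ^ 2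

lemma powLogDeriv_one (k : ℕ) (x : ℝ) : powLogDeriv k 1 x = x ^ k * Real.log x := by
  have : (k.factorial : ℝ) ≠ 0 := by positivity
  simp [powLogDeriv, this]

lemma hasDerivAt_powLogDeriv {k j : ℕ} (hj : j ≤ k + 2) {x : ℝ} (hx : 0 < x) :
    HasDerivAt (powLogDeriv k j) (powLogDeriv k (j + 1) x) x := by
  have hlog := Real.hasDerivAt_log hx.ne'
  have hx' := hx.ne'
  rcases j with _ | j
  · have hk : (k : ℝ) + 1 ≠ 0 := by positivity
    have h := ((hasDerivAt_pow (k + 1) x).div_const ((k : ℝ) + 1)).mul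
      (hlog.sub_const (1 / ((k : ℝ) + 1)))
    refine h.congr_deriv ?_
    rw [zero_add, powLogDeriv_one]
    push_cast
    field_simp
    ring
  · rcases lt_trichotomy j k with h | h | h
    · have e1 : powLogDeriv k (j + 1) = fun x =>
          (k.factorial : ℝ) / ((k - j).factorial : ℝ) * x ^ (k - j)
          * (Real.log x + ∑ l ∈ Finset.Icc 1 j, 1 / ((k : ℝ) - (l : ℝ) + 1)) := by
        funext y; simp only [powLogDeriv, if_pos h.le]
      rw [e1]
      have h1 := ((hasDerivAt_pow (k - j) x).const_mul
        ((k.factorial : ℝ) / ((k - j).factorial : ℝ))).mul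
        (hlog.add_const (∑ l ∈ Finset.Icc 1 j, 1 / ((k : ℝ) - (l : ℝ) + 1)))
      refine h1.congr_deriv ?_
      obtain ⟨d, rfl⟩ : ∃ d, k = j + 1 + d := ⟨k - (j + 1), by omega⟩
      have e2 : j + 1 + d - j = d + 1 := by omega
      have e3 : j + 1 + d - (j + 1) = d := by omega
      simp only [powLogDeriv, if_pos (show j + 1 ≤ j + 1 + d by omega), e2, e3,
        Nat.add_sub_cancel, Finset.sum_Icc_succ_top (show 1 ≤ j + 1 by omega), Nat.factorial_succ d]
      have hd : (d : ℝ) + 1 ≠ 0 := by positivity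
      have hf : (d.factorial : ℝ) ≠ 0 := by positivity
      -- Differentiating the logarithm contributes `1/(k - j)` relative to the new leading factor:
      -- exactly the `l = j + 1` term of the harmonic sum.
      have e4 : (((j + 1 + d : ℕ) : ℝ) - ((j + 1 : ℕ) : ℝ) + 1) = (d : ℝ) + 1 := by
        push_cast; ring
      rw [e4]
      generalize (∑ l ∈ Finset.Icc 1 j, 1 / (((j + 1 + d : ℕ) : ℝ) - (l : ℝ) + 1)) = s
      generalize ((j + 1 + d).factorial : ℝ) = c
      push_cast
      field_simp
      ring
    · subst h
      have e1 : powLogDeriv j (j + 1) = fun x =>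
          (j.factorial : ℝ) * (Real.log x + ∑ l ∈ Finset.Icc 1 j, 1 / ((j : ℝ) - (l : ℝ) + 1)) := by
        funext y; simp [powLogDeriv]
      rw [e1]
      refine ((hlog.add_const _).const_mul _).congr_deriv ?_
      simp [powLogDeriv, div_eq_mul_inv]
    · obtain rfl : j = k + 1 := by omega
      have e1 : powLogDeriv k (k + 1 + 1) = fun x => (k.factorial : ℝ) * x⁻¹ := by
        funext y; simp [powLogDeriv, div_eq_mul_inv]
      rw [e1]
      refine ((hasDerivAt_inv hx').const_mul _).congr_deriv ?_
      simp [powLogDeriv, div_eq_mul_inv]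

/-- The Euler–Maclaurin approximation, up to a constant, of `∑ j ≤ x, j ^ k * log j`. -/
noncomputable def powLogEulerMaclaurin (k : ℕ) (x : ℝ) : ℝ :=
  ∑ j ∈ Finset.range (k + 3), (bernoulli' j : ℝ) / (j.factorial : ℝ) * powLogDeriv k j x

/-- Repeated integration by parts against Bernoulli polynomials, written as a mean value estimate
for one function `T` on `[0, 1]`. Since `g (j + 1)' = -g j`, the derivative of `T` telescopes to its
last term, which contains the derivative `-k!/(a + x)²`. -/
lemma exists_powLogEulerMaclaurin_step_bound (k : ℕ) :
    ∃ C : ℝ, ∀ a : ℝ, 0 < a →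
      |(a + 1) ^ k * Real.log (a + 1)
        - (powLogEulerMaclaurin k (a + 1) - powLogEulerMaclaurin k a)| ≤ C / a ^ 2 := by
  obtain ⟨M, hM⟩ := isCompact_Icc.exists_bound_of_continuousOn
    (s := Set.Icc (0 : ℝ) 1) (continuous_bernoulliFun (k + 2)).continuousOn
  refine ⟨M / ((k + 2).factorial : ℝ) * (k.factorial : ℝ), fun a ha => ?_⟩
  set g : ℕ → ℝ → ℝ := fun j x => (-1) ^ j * bernoulliFun j x / (j.factorial : ℝ) with hg
  set T : ℝ → ℝ := fun x => ∑ j ∈ Finset.range (k + 3), g j x * powLogDeriv k j (a + x) with hT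
  have hg0 : ∀ x, HasDerivAt (g 0) 0 x := by
    intro x
    have : g 0 = fun _ => 1 := by funext y; simp [hg]
    rw [this]; exact hasDerivAt_const _ _
  have hgs : ∀ j x, HasDerivAt (g (j + 1)) (-g j x) x := by
    intro j x
    have h := ((hasDerivAt_bernoulliFun (j + 1) x).const_mul ((-1) ^ (j + 1))).div_const
      ((j + 1).factorial : ℝ)
    refine h.congr_deriv ?_
    have h1 : (j : ℝ) + 1 ≠ 0 := by positivity
    have h2 : (j.factorial : ℝ) ≠ 0 := by positivity
    simp only [hg, Nat.factorial_succ, Nat.add_sub_cancel]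
    push_cast
    field_simp
    ring
  have hTd : ∀ n ≤ k + 3, ∀ x : ℝ, 0 ≤ x →
      HasDerivAt (fun x => ∑ j ∈ Finset.range n, g j x * powLogDeriv k j (a + x))
        (if n = 0 then 0 else g (n - 1) x * powLogDeriv k n (a + x)) x := by
    intro n
    induction n with
    | zero => intro _ x _; simpa using hasDerivAt_const x (0 : ℝ)
    | succ n ih =>
      intro hn x hx
      simp only [Finset.sum_range_succ]
      have hD : HasDerivAt (fun y => powLogDeriv k n (a + y)) (powLogDeriv k (n + 1) (a + x)) x := by
        have := (hasDerivAt_powLogDeriv (k := k) (j := n) (by omega)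
          (show 0 < a + x by linarith)).comp_const_add a x
        exact this
      rcases n with _ | n
      · refine ((ih (by omega) x hx).add ((hg0 x).mul hD)).congr_deriv ?_
        simp
      · refine ((ih (by omega) x hx).add ((hgs n x).mul hD)).congr_deriv ?_
        simp
  have hTd' : ∀ x ∈ Set.Icc (0 : ℝ) 1, HasDerivWithinAt T
      (g (k + 2) x * powLogDeriv k (k + 3) (a + x)) (Set.Icc 0 1) x := fun x hx =>
    (by simpa using hTd (k + 3) le_rfl x hx.1 : HasDerivAt T _ x).hasDerivWithinAt
  have hbound : ∀ x ∈ Set.Icc (0 : ℝ) 1,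
      ‖g (k + 2) x * powLogDeriv k (k + 3) (a + x)‖
        ≤ M / ((k + 2).factorial : ℝ) * (k.factorial : ℝ) / a ^ 2 := by
    intro x hx
    have h1 := hM x hx
    have hM0 : 0 ≤ M := (norm_nonneg _).trans h1
    have hax : 0 < a + x := by linarith [hx.1]
    have h2 : ‖g (k + 2) x‖ ≤ M / ((k + 2).factorial : ℝ) := by
      simp only [hg, norm_div, norm_mul, norm_pow, norm_neg, norm_one, one_pow, one_mul]
      rw [Real.norm_of_nonneg (by positivity : (0 : ℝ) ≤ ((k + 2).factorial : ℝ))]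
      gcongr
    have h3 : ‖powLogDeriv k (k + 3) (a + x)‖ ≤ (k.factorial : ℝ) / a ^ 2 := by
      have : powLogDeriv k (k + 3) (a + x) = -(k.factorial : ℝ) / (a + x) ^ 2 := by
        simp [powLogDeriv]
      rw [this, norm_div, norm_neg, Real.norm_of_nonneg (by positivity),
        Real.norm_of_nonneg (by positivity)]
      gcongr
      linarith [hx.1]
    rw [norm_mul, mul_div_assoc]
    exact mul_le_mul h2 h3 (norm_nonneg _) (by positivity)
  have hmv := (convex_Icc (0 : ℝ) 1).norm_image_sub_le_of_norm_hasDerivWithin_le hTd' hbound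
    (Set.right_mem_Icc.2 zero_le_one) (Set.left_mem_Icc.2 zero_le_one)
  have hval : T 0 - T 1 = (a + 1) ^ k * Real.log (a + 1)
        - (powLogEulerMaclaurin k (a + 1) - powLogEulerMaclaurin k a) := by
    -- The values of `bernoulliFun j` at 0 and 1 differ only for `j = 1`; that jump produces the
    -- summand `(a + 1)^k log (a + 1)`.
    have hB : ∀ j, (-1 : ℝ) ^ j * bernoulliFun j 0 = (bernoulli' j : ℝ) := by
      intro j
      rw [bernoulliFun_eval_zero, bernoulli]
      push_cast
      rw [← mul_assoc, ← mul_pow]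
      simp
    have h0 : T 0 = powLogEulerMaclaurin k a := by
      simp only [hT, hg, powLogEulerMaclaurin, add_zero, hB]
    have h1 : T 1 = powLogEulerMaclaurin k (a + 1) - (a + 1) ^ k * Real.log (a + 1) := by
      have : ∀ j, g j 1 * powLogDeriv k j (a + 1) =
          (bernoulli' j : ℝ) / (j.factorial : ℝ) * powLogDeriv k j (a + 1)
            - if j = 1 then (a + 1) ^ k * Real.log (a + 1) else 0 := by
        intro j
        simp only [hg]
        rw [bernoulliFun_eval_one, mul_add, hB]
        split_ifs with h
        · subst h
          rw [powLogDeriv_one]; simp; ring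
        · simp
      simp only [hT, this, Finset.sum_sub_distrib, powLogEulerMaclaurin]
      simp
    rw [h0, h1]; ring
  rw [← hval]
  simpa [Real.norm_eq_abs] using hmv

/-- The two expressions differ by the constant that `1 - δ` discards at order `k` and by a term of
order `1/n`, so both give convergent sequences. -/
lemma powLogEulerMaclaurin_eq (k n : ℕ) :
    powLogEulerMaclaurin k n = glaisherCorrection n k
      + (bernoulli' (k + 1) : ℝ) / ((k + 1).factorial : ℝ) * (k.factorial : ℝ)
        * (∑ l ∈ Finset.Icc 1 k, 1 / ((k : ℝ) - (l : ℝ) + 1))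
      + (bernoulli' (k + 2) : ℝ) / ((k + 2).factorial : ℝ) * ((k.factorial : ℝ) / n) := by
  have hk : (k.factorial : ℝ) ≠ 0 := by positivity
  have htop : powLogDeriv k (k + 2) n = (k.factorial : ℝ) / n := by simp [powLogDeriv]
  have hmid : ∑ i ∈ Finset.range k, (bernoulli' (i + 2) : ℝ) / ((i + 2).factorial : ℝ)
        * powLogDeriv k (i + 2) n
      = (k.factorial : ℝ) * (∑ m ∈ Finset.Icc 1 k,
        (n : ℝ) ^ (k - m) * (bernoulli (m + 1) : ℝ)
          / (((m + 1).factorial : ℝ) * ((k - m).factorial : ℝ))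
        * (Real.log n + (1 - if k = m then (1 : ℝ) else 0)
              * ∑ l ∈ Finset.Icc 1 m, 1 / ((k : ℝ) - (l : ℝ) + 1)))
        + (bernoulli' (k + 1) : ℝ) / ((k + 1).factorial : ℝ) * (k.factorial : ℝ)
        * (∑ l ∈ Finset.Icc 1 k, 1 / ((k : ℝ) - (l : ℝ) + 1)) := by
    have hIcc : ∀ F : ℕ → ℝ, ∑ m ∈ Finset.Icc 1 k, F m = ∑ i ∈ Finset.range k, F (1 + i) := by
      intro F
      rw [← Finset.Ico_add_one_right_eq_Icc 1 k, Finset.sum_Ico_eq_sum_range, Nat.add_sub_cancel]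
    have hlast : (bernoulli' (k + 1) : ℝ) / ((k + 1).factorial : ℝ) * (k.factorial : ℝ)
        * (∑ l ∈ Finset.Icc 1 k, 1 / ((k : ℝ) - (l : ℝ) + 1)) =
        ∑ i ∈ Finset.range k, if k = 1 + i then
          (bernoulli' (k + 1) : ℝ) / ((k + 1).factorial : ℝ) * (k.factorial : ℝ)
          * (∑ l ∈ Finset.Icc 1 k, 1 / ((k : ℝ) - (l : ℝ) + 1)) else 0 := by
      generalize hH : (∑ l ∈ Finset.Icc 1 k, 1 / ((k : ℝ) - (l : ℝ) + 1)) = H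
      rcases k with _ | k
      · simp [← hH]
      · rw [Finset.sum_eq_single k]
        · rw [if_pos (by omega)]
        · intro b _ hb; rw [if_neg (by omega)]
        · intro h; simp at h
    rw [hlast, hIcc (fun m => (n : ℝ) ^ (k - m) * (bernoulli (m + 1) : ℝ)
          / (((m + 1).factorial : ℝ) * ((k - m).factorial : ℝ))
        * (Real.log n + (1 - if k = m then (1 : ℝ) else 0)
              * ∑ l ∈ Finset.Icc 1 m, 1 / ((k : ℝ) - (l : ℝ) + 1))), Finset.mul_sum,
      ← Finset.sum_add_distrib]
    refine Finset.sum_congr rfl fun i hi => ?_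
    have hi' := Finset.mem_range.1 hi
    rw [bernoulli_eq_bernoulli'_of_ne_one (show 1 + i + 1 ≠ 1 by omega)]
    simp only [powLogDeriv, if_pos (show i + 1 ≤ k by omega), add_comm 1 i]
    by_cases h : k = i + 1
    · subst h
      simp
      ring
    · simp only [h, if_false]
      ring
  rw [powLogEulerMaclaurin, Finset.sum_range_succ, Finset.sum_range_succ', Finset.sum_range_succ',
    hmid, htop, powLogDeriv_one]
  simp only [powLogDeriv, glaisherCorrection, bernoulli'_zero]
  push_cast
  simp
  ring

theorem tendsto_glaisherSeq (k : ℕ) :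
    Tendsto (glaisherSeq k) atTop (𝓝 (Real.log (generalizedGlaisher k))) := by
  rw [generalizedGlaisher, Real.log_exp]
  apply tendsto_nhds_limUnder
  obtain ⟨C, hC⟩ := exists_powLogEulerMaclaurin_step_bound k
  set u : ℕ → ℝ := fun n => (∑ m ∈ Finset.Icc 1 (n + 1), (m : ℝ) ^ k * Real.log m)
    - powLogEulerMaclaurin k ((n + 1 : ℕ) : ℝ) with hu
  have hcau : CauchySeq u := by
    refine cauchySeq_of_summable_dist (Summable.of_nonneg_of_le (fun _ => dist_nonneg)
      (g := fun n => dist (u n) (u n.succ)) (f := fun n : ℕ => C / (((n + 1 : ℕ) : ℝ)) ^ 2) ?_ ?_)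
    · intro n
      rw [dist_comm, Real.dist_eq]
      have := hC ((n + 1 : ℕ) : ℝ) (by positivity)
      convert this using 2
      simp only [hu, Nat.succ_eq_add_one]
      rw [Finset.sum_Icc_succ_top (show 1 ≤ n + 1 + 1 by omega)]
      push_cast
      ring
    · have := (summable_nat_add_iff 1).2 (Real.summable_one_div_nat_pow.2 one_lt_two)
      simpa [div_eq_mul_inv] using this.mul_left C
  obtain ⟨L, hL⟩ := cauchySeq_tendsto_of_complete hcau
  refine ⟨L + (bernoulli' (k + 1) : ℝ) / ((k + 1).factorial : ℝ) * (k.factorial : ℝ)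
        * (∑ l ∈ Finset.Icc 1 k, 1 / ((k : ℝ) - (l : ℝ) + 1))
      + (bernoulli' (k + 2) : ℝ) / ((k + 2).factorial : ℝ) * 0, ?_⟩
  rw [← tendsto_add_atTop_iff_nat 1]
  have hlim : Tendsto (fun n : ℕ => (k.factorial : ℝ) / ((n + 1 : ℕ) : ℝ)) atTop (𝓝 0) :=
    (tendsto_add_atTop_iff_nat 1).2 (tendsto_const_div_atTop_nhds_zero_nat _)
  refine ((hL.add_const _).add (hlim.const_mul _)).congr fun n => ?_
  simp only [hu, glaisherSeq]
  rw [powLogEulerMaclaurin_eq]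
  ring

/-! ### Integrability of log Γ at 0. -/

lemma continuousOn_logGamma : ContinuousOn logGamma (Set.Ioi 0) := fun _ hx =>
  ((Real.differentiableOn_Gamma_Ioi.continuousOn.continuousAt (Ioi_mem_nhds hx)).log
    (Real.Gamma_pos_of_pos hx).ne').continuousWithinAt

lemma logGamma_add_one {x : ℝ} (hx : 0 < x) : logGamma (x + 1) = logGamma x + Real.log x := by
  rw [logGamma, logGamma, Real.Gamma_add_one hx.ne',
    Real.log_mul hx.ne' (Real.Gamma_pos_of_pos hx).ne', add_comm]

lemma intervalIntegrable_logGamma : IntervalIntegrable logGamma MeasureTheory.volume 0 1 := by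
  have h1 : ContinuousOn (fun x : ℝ => logGamma (x + 1)) (Set.uIcc 0 1) := by
    refine continuousOn_logGamma.comp (by fun_prop) fun x hx => ?_
    rw [Set.uIcc_of_le zero_le_one] at hx
    have := hx.1
    exact Set.mem_Ioi.2 (by linarith)
  refine (h1.intervalIntegrable.sub (intervalIntegral.intervalIntegrable_log')).congr ?_
  intro x hx
  rw [Set.uIoc_of_le zero_le_one] at hx
  simp only [logGamma_add_one hx.1]
  ring

/-! ### Repeated integrals and the Riemann–Liouville integral. -/

section Repeated

variable {f : ℝ → ℝ}

lemma continuousOn_repeatedIntegral (hi : IntervalIntegrable f MeasureTheory.volume 0 1) (n : ℕ) :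
    ContinuousOn (repeatedIntegral 0 f (n + 1)) (Set.Icc 0 1) := by
  induction n with
  | zero =>
    have := intervalIntegral.continuousOn_primitive_interval (μ := MeasureTheory.volume)
      ((intervalIntegrable_iff' (by finiteness)).1 hi)
    rwa [Set.uIcc_of_le zero_le_one] at this
  | succ n ih =>
    rw [← Set.uIcc_of_le zero_le_one] at ih
    have := intervalIntegral.continuousOn_primitive_interval (μ := MeasureTheory.volume)
      ((intervalIntegrable_iff' (by finiteness)).1 ih.intervalIntegrable)
    rwa [Set.uIcc_of_le zero_le_one] at this

lemma intervalIntegrable_repeatedIntegral (hi : IntervalIntegrable f MeasureTheory.volume 0 1)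
    (n : ℕ) : IntervalIntegrable (repeatedIntegral 0 f n) MeasureTheory.volume 0 1 := by
  rcases n with _ | n
  · exact hi
  · exact (continuousOn_repeatedIntegral hi n).intervalIntegrable_of_Icc zero_le_one

lemma continuousOn_repeatedIntegral_Ioo (hc : ContinuousOn f (Set.Ioo 0 1))
    (hi : IntervalIntegrable f MeasureTheory.volume 0 1) (n : ℕ) :
    ContinuousOn (repeatedIntegral 0 f n) (Set.Ioo 0 1) := by
  rcases n with _ | n
  · exact hc
  · exact (continuousOn_repeatedIntegral hi n).mono Set.Ioo_subset_Icc_self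

lemma hasDerivAt_repeatedIntegral (hc : ContinuousOn f (Set.Ioo 0 1))
    (hi : IntervalIntegrable f MeasureTheory.volume 0 1) (n : ℕ) {x : ℝ}
    (hx : x ∈ Set.Ioo (0 : ℝ) 1) :
    HasDerivAt (repeatedIntegral 0 f (n + 1)) (repeatedIntegral 0 f n x) x := by
  have hcn := continuousOn_repeatedIntegral_Ioo hc hi n
  refine intervalIntegral.integral_hasDerivAt_right ?_
    (hcn.stronglyMeasurableAtFilter isOpen_Ioo x hx) (hcn.continuousAt (isOpen_Ioo.mem_nhds hx))
  refine (intervalIntegrable_repeatedIntegral hi n).mono_set ?_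
  rw [Set.uIcc_of_le hx.1.le, Set.uIcc_of_le zero_le_one]
  exact Set.Icc_subset_Icc_right hx.2.le

/-- Cauchy's formula for repeated integration on `[0, 1]`. -/
lemma repeatedIntegral_succ_one (hc : ContinuousOn f (Set.Ioo 0 1))
    (hi : IntervalIntegrable f MeasureTheory.volume 0 1) (n : ℕ) :
    repeatedIntegral 0 f (n + 1) 1
      = 1 / (n.factorial : ℝ) * ∫ t in (0 : ℝ)..1, (1 - t) ^ n * f t := by
  -- Integration by parts; the boundary terms vanish, one factor being zero at 1 and the other at 0.
  have step : ∀ i j : ℕ, ∫ t in (0 : ℝ)..1, (1 - t) ^ (i + 1) * repeatedIntegral 0 f j t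
      = ((i : ℝ) + 1) * ∫ t in (0 : ℝ)..1, (1 - t) ^ i * repeatedIntegral 0 f (j + 1) t := by
    intro i j
    have hu : ∀ x : ℝ, HasDerivAt (fun t : ℝ => (1 - t) ^ (i + 1))
        (-(((i : ℝ) + 1) * (1 - x) ^ i)) x := by
      intro x
      refine (((hasDerivAt_id x).const_sub 1).pow (i + 1)).congr_deriv ?_
      push_cast
      simp
    have hv := continuousOn_repeatedIntegral hi j
    rw [← Set.uIcc_of_le zero_le_one] at hv
    rw [intervalIntegral.integral_mul_deriv_eq_deriv_mul_of_hasDerivAt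
      (u := fun t : ℝ => (1 - t) ^ (i + 1)) (v := repeatedIntegral 0 f (j + 1))
      (u' := fun x => -(((i : ℝ) + 1) * (1 - x) ^ i))
      (by fun_prop) hv (fun x _ => hu x)
      (fun x hx => hasDerivAt_repeatedIntegral hc hi j (by simpa using hx))
      (Continuous.intervalIntegrable (by fun_prop) _ _)
      (intervalIntegrable_repeatedIntegral hi j)]
    have h0 : repeatedIntegral 0 f (j + 1) 0 = 0 := intervalIntegral.integral_same
    simp only [h0, neg_mul, intervalIntegral.integral_neg, mul_assoc,
      intervalIntegral.integral_const_mul]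
    simp
  have main : ∀ i j : ℕ, ∫ t in (0 : ℝ)..1, (1 - t) ^ i * repeatedIntegral 0 f j t
      = (i.factorial : ℝ) * repeatedIntegral 0 f (i + j + 1) 1 := by
    intro i
    induction i with
    | zero => intro j; simp [repeatedIntegral]
    | succ i ih =>
      intro j
      rw [step, ih, Nat.factorial_succ, show i + (j + 1) + 1 = i + 1 + j + 1 by ring]
      push_cast
      ring
  have h := main n 0
  have hn : (n.factorial : ℝ) ≠ 0 := by positivity
  rw [show (∫ t in (0 : ℝ)..1, (1 - t) ^ n * f t) =
    ∫ t in (0 : ℝ)..1, (1 - t) ^ n * repeatedIntegral 0 f 0 t from rfl, h]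
  field_simp

end Repeated

lemma sub_cpow_nat_sub_one {m : ℕ} (hm : 1 ≤ m) (s : ℝ) :
    (s : ℂ) ^ ((m : ℂ) - 1) = ((s ^ (m - 1) : ℝ) : ℂ) := by
  rw [show ((m : ℂ) - 1) = ((m - 1 : ℕ) : ℂ) by push_cast [hm]; ring, Complex.cpow_natCast]
  push_cast
  rfl

lemma leftRiemannLiouville_natCast {m : ℕ} (hm : 1 ≤ m) (f : ℝ → ℝ) :
    leftRiemannLiouville 0 (m : ℂ) f 1
      = ((1 / ((m - 1).factorial : ℝ) * ∫ t in (0 : ℝ)..1, (1 - t) ^ (m - 1) * f t : ℝ) : ℂ) := by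
  obtain ⟨n, rfl⟩ : ∃ n, m = n + 1 := ⟨m - 1, by omega⟩
  rw [leftRiemannLiouville]
  simp only [sub_cpow_nat_sub_one hm, ← Complex.ofReal_mul, intervalIntegral.integral_ofReal]
  rw [Nat.add_sub_cancel, Nat.cast_add, Nat.cast_one, Complex.Gamma_nat_eq_factorial]
  push_cast
  rfl

lemma intervalIntegrable_pow_mul_logGamma (n : ℕ) :
    IntervalIntegrable (fun t => (1 - t) ^ n * logGamma t) MeasureTheory.volume 0 1 :=
  intervalIntegrable_logGamma.continuousOn_mul (by fun_prop)

/-! ### Moments of shifted logarithms. -/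

lemma intervalIntegrable_log_add (a : ℝ) :
    IntervalIntegrable (fun t : ℝ => Real.log (t + a)) MeasureTheory.volume 0 1 := by
  have := (intervalIntegral.intervalIntegrable_log' (a := 0 + a) (b := 1 + a)).comp_add_right a
  simpa using this

/-- `∫₀¹ (1 - t) ^ (m - 1) log (t + a) dt`, with `m = n + 1`. -/
lemma integral_pow_mul_log_add (n : ℕ) {a : ℝ} (ha : 0 ≤ a) :
    ((n : ℝ) + 1) * ∫ t in (0 : ℝ)..1, (1 - t) ^ n * Real.log (t + a)
      = (a + 1) ^ (n + 1) * Real.log (a + 1) - ((a + 1) ^ (n + 1) - 1) * Real.log a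
        - ∑ i ∈ Finset.range (n + 1), (a + 1) ^ i / ((n : ℝ) + 1 - i) := by
  -- The primitive `((a+1)^(n+1) - (1-t)^(n+1)) log (t + a)` has its constant chosen to vanish at `t
  -- = -a`. Factoring out `t + a` leaves `P`, so continuity at 0 holds even for `a = 0`.
  set P : ℝ → ℝ := fun t => ∑ i ∈ Finset.range (n + 1), (a + 1) ^ i * (1 - t) ^ (n - i) with hP
  have hgeom : ∀ t, P t * (t + a) = (a + 1) ^ (n + 1) - (1 - t) ^ (n + 1) := by
    intro t
    rw [← (Commute.all (a + 1) (1 - t)).geom_sum₂_mul (n + 1), hP]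
    simp only [Nat.add_sub_cancel]
    ring
  have hlogint := intervalIntegrable_log_add a
  have hderiv : ∀ t ∈ Set.Ioo (0 : ℝ) 1, HasDerivAt (fun t => P t * ((t + a) * Real.log (t + a)))
      (((n : ℝ) + 1) * ((1 - t) ^ n * Real.log (t + a)) + P t) t := by
    intro t ht
    have hta : 0 < t + a := by linarith [ht.1]
    have e : (fun t => P t * ((t + a) * Real.log (t + a)))
        = fun t => ((a + 1) ^ (n + 1) - (1 - t) ^ (n + 1)) * Real.log (t + a) := by
      funext y; rw [← mul_assoc, hgeom]
    rw [e]
    refine ((((((hasDerivAt_id t).const_sub 1).pow (n + 1)).const_sub ((a + 1) ^ (n + 1)))).mul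
      (((hasDerivAt_id t).add_const a).log hta.ne')).congr_deriv ?_
    simp only [Pi.pow_apply, id]
    rw [← hgeom t]
    push_cast
    field_simp
  have hPc : Continuous P := by fun_prop
  have hI1 : IntervalIntegrable (fun t => ((n : ℝ) + 1) * ((1 - t) ^ n * Real.log (t + a)))
      MeasureTheory.volume 0 1 :=
    (hlogint.continuousOn_mul (by fun_prop)).const_mul _
  have hI2 := hPc.intervalIntegrable (μ := MeasureTheory.volume) 0 1
  have hcont : Continuous (fun t => P t * ((t + a) * Real.log (t + a))) :=
    hPc.mul (Real.continuous_mul_log.comp (by fun_prop : Continuous fun t : ℝ => t + a))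
  have hftc := intervalIntegral.integral_eq_sub_of_hasDerivAt_of_le zero_le_one
    hcont.continuousOn hderiv (hI1.add hI2)
  rw [intervalIntegral.integral_add hI1 hI2, intervalIntegral.integral_const_mul] at hftc
  have hPint : ∫ t in (0 : ℝ)..1, P t
      = ∑ i ∈ Finset.range (n + 1), (a + 1) ^ i / ((n : ℝ) + 1 - i) := by
    rw [hP, intervalIntegral.integral_finsetSum
      fun i _ => Continuous.intervalIntegrable (by fun_prop) _ _]
    refine Finset.sum_congr rfl fun i hi => ?_
    have hi' : i ≤ n := Nat.lt_succ_iff.1 (Finset.mem_range.1 hi)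
    rw [intervalIntegral.integral_const_mul,
      intervalIntegral.integral_comp_sub_left (fun t : ℝ => t ^ (n - i)) 1, integral_pow]
    push_cast [hi']
    simp
    ring
  have h0 : P 0 * ((0 + a) * Real.log (0 + a)) = ((a + 1) ^ (n + 1) - 1) * Real.log a := by
    rw [← mul_assoc, hgeom]; simp
  have h1 : P 1 * ((1 + a) * Real.log (1 + a)) = (a + 1) ^ (n + 1) * Real.log (a + 1) := by
    rw [← mul_assoc, hgeom]; simp [add_comm]
  rw [h0, h1, hPint] at hftc
  linarith

/-! ### From Euler's sequence to the Glaisher sums. -/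

lemma tendsto_log_succ_sub_log :
    Tendsto (fun n : ℕ => Real.log ((n : ℝ) + 1) - Real.log n) atTop (𝓝 0) :=
  Real.tendsto_log_nat_add_one_sub_log

/-- Both bounds come from log-convexity of Γ (Bohr–Mollerup). Being uniform in `x`, the estimate
lets limit and integral be exchanged despite the singularity at 0. -/
lemma abs_logGamma_sub_logGammaSeq_le {x : ℝ} (hx : 0 < x) (hx' : x ≤ 1) {n : ℕ} (hn : n ≠ 0) :
    |logGamma x - Real.BohrMollerup.logGammaSeq x n| ≤ Real.log ((n : ℝ) + 1) - Real.log n := by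
  have hfeq : ∀ {y : ℝ}, 0 < y → (Real.log ∘ Real.Gamma) (y + 1)
      = (Real.log ∘ Real.Gamma) y + Real.log y := fun {y} hy => logGamma_add_one hy
  have h1 := Real.BohrMollerup.le_logGammaSeq Real.convexOn_log_Gamma hfeq hx hx' n
  have h2 := Real.BohrMollerup.ge_logGammaSeq Real.convexOn_log_Gamma hfeq hx hn
  simp only [Function.comp_apply, Real.Gamma_one, Real.log_one, zero_add] at h1 h2
  have hn0 : (0 : ℝ) < n := by positivity
  have hmono : 0 ≤ Real.log ((n : ℝ) + 1) - Real.log n :=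
    sub_nonneg.2 (Real.log_le_log hn0 (by linarith))
  have h3 : x * (Real.log ((n : ℝ) + 1) - Real.log n) ≤ Real.log ((n : ℝ) + 1) - Real.log n :=
    mul_le_of_le_one_left hmono hx'
  rw [logGamma, abs_le]
  constructor <;> linarith

lemma intervalIntegrable_logGammaSeq (n : ℕ) :
    IntervalIntegrable (fun t => Real.BohrMollerup.logGammaSeq t n) MeasureTheory.volume 0 1 := by
  unfold Real.BohrMollerup.logGammaSeq
  refine (Continuous.intervalIntegrable (by fun_prop) _ _).sub ?_
  have := IntervalIntegrable.sum (μ := MeasureTheory.volume) (a := 0) (b := 1)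
    (Finset.range (n + 1)) (f := fun (j : ℕ) (t : ℝ) => Real.log (t + j))
    fun j _ => intervalIntegrable_log_add j
  refine this.congr fun t _ => ?_
  simp

lemma tendsto_integral_logGammaSeq (q : ℕ) :
    Tendsto (fun n : ℕ => ∫ t in (0 : ℝ)..1, (1 - t) ^ q * Real.BohrMollerup.logGammaSeq t n)
      atTop (𝓝 (∫ t in (0 : ℝ)..1, (1 - t) ^ q * logGamma t)) := by
  rw [tendsto_iff_norm_sub_tendsto_zero]
  refine squeeze_zero' (Eventually.of_forall fun _ => norm_nonneg _) ?_ tendsto_log_succ_sub_log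
  filter_upwards [eventually_ne_atTop 0] with n hn
  rw [← intervalIntegral.integral_sub
    ((intervalIntegrable_logGammaSeq n).continuousOn_mul (by fun_prop))
    (intervalIntegrable_pow_mul_logGamma q)]
  refine (intervalIntegral.norm_integral_le_of_norm_le_const
    (C := Real.log ((n : ℝ) + 1) - Real.log n) fun t ht => ?_).trans (by simp)
  rw [Set.uIoc_of_le zero_le_one] at ht
  have h := abs_logGamma_sub_logGammaSeq_le ht.1 ht.2 hn
  rw [← mul_sub, norm_mul, Real.norm_eq_abs, Real.norm_eq_abs, abs_sub_comm _ (logGamma t)]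
  have h1 : |(1 - t) ^ q| ≤ 1 := by
    rw [abs_pow]
    exact pow_le_one₀ (abs_nonneg _) (abs_le.2 ⟨by linarith [ht.2], by linarith [ht.1]⟩)
  calc _ ≤ 1 * |logGamma t - Real.BohrMollerup.logGammaSeq t n| := by gcongr
    _ ≤ _ := by rwa [one_mul]

/-- Telescope `(j+1)^m log (j+1) - j^m log j` and expand `(j+1)^m - j^m` binomially. The `j = 0`
terms rely on `Real.log 0 = 0`. -/
lemma sum_pow_succ_mul_log (m N : ℕ) :
    ∑ j ∈ Finset.range N, (((j : ℝ) + 1) ^ m * Real.log ((j : ℝ) + 1)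
        - (((j : ℝ) + 1) ^ m - 1) * Real.log j)
      = (N : ℝ) ^ m * Real.log N
        - ∑ k ∈ Finset.range m, (m.choose k : ℝ) * ∑ j ∈ Finset.range N, (j : ℝ) ^ k * Real.log j
        + ∑ j ∈ Finset.range N, Real.log j := by
  induction N with
  | zero => simp
  | succ N ih =>
    have hb : ((N : ℝ) + 1) ^ m
        = ∑ k ∈ Finset.range m, (m.choose k : ℝ) * (N : ℝ) ^ k + (N : ℝ) ^ m := by
      rw [add_pow, Finset.sum_range_succ]
      simp [mul_comm]
    simp only [Finset.sum_range_succ _ N, ih, mul_add, Finset.sum_add_distrib]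
    simp only [← mul_assoc, ← Finset.sum_mul]
    push_cast
    linear_combination (-Real.log N) * hb

lemma log_factorial_eq_sum (n : ℕ) :
    Real.log (n.factorial : ℝ) = ∑ j ∈ Finset.range (n + 1), Real.log (j : ℝ) := by
  induction n with
  | zero => simp
  | succ n ih =>
    rw [Finset.sum_range_succ, ← ih, Nat.factorial_succ]
    push_cast
    rw [Real.log_mul (by positivity) (by positivity), add_comm]

lemma sum_range_pow_mul_log (k n : ℕ) :
    ∑ j ∈ Finset.range (n + 1), (j : ℝ) ^ k * Real.log j
      = glaisherSeq k (n + 1) + glaisherCorrection (n + 1) k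
        - ((n + 1 : ℕ) : ℝ) ^ k * Real.log ((n + 1 : ℕ) : ℝ) := by
  rw [glaisherSeq, sub_add_cancel, Finset.sum_Icc_succ_top (by omega), add_sub_cancel_right,
    Finset.range_eq_Ico, Finset.sum_eq_sum_Ico_succ_bot (by omega)]
  simp
  rfl

lemma integral_pow_mul_logGammaSeq (q n : ℕ) :
    ((q : ℝ) + 1) * ∫ t in (0 : ℝ)..1, (1 - t) ^ q * Real.BohrMollerup.logGammaSeq t n
      = (((q : ℝ) + 1) * ∫ t in (0 : ℝ)..1, (1 - t) ^ q * t) * Real.log n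
        - ((n + 1 : ℕ) : ℝ) ^ (q + 1) * Real.log ((n + 1 : ℕ) : ℝ)
        + (∑ k ∈ Finset.range (q + 1), ((q + 1).choose k : ℝ)
          * ∑ j ∈ Finset.range (n + 1), (j : ℝ) ^ k * Real.log j)
        + ∑ i ∈ Finset.range (q + 1), 1 / ((q : ℝ) + 1 - i)
          * ∑ j ∈ Finset.range (n + 1), ((j : ℝ) + 1) ^ i := by
  have hlin : Continuous fun t : ℝ => (1 - t) ^ q * t * Real.log n := by fun_prop
  have hcst : Continuous fun t : ℝ => (1 - t) ^ q * Real.log (n.factorial : ℝ) := by fun_prop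
  have hone : ((q : ℝ) + 1) * ∫ t in (0 : ℝ)..1, (1 - t) ^ q = 1 := by
    have : (q : ℝ) + 1 ≠ 0 := by positivity
    rw [intervalIntegral.integral_comp_sub_left (fun t : ℝ => t ^ q) 1, integral_pow]
    simp
    field_simp
  have hlogs : ∀ j ∈ Finset.range (n + 1), IntervalIntegrable
      (fun t : ℝ => (1 - t) ^ q * Real.log (t + j)) MeasureTheory.volume 0 1 := fun j _ =>
    (intervalIntegrable_log_add j).continuousOn_mul (by fun_prop)
  have hsum : IntervalIntegrable
      (fun t : ℝ => ∑ j ∈ Finset.range (n + 1), (1 - t) ^ q * Real.log (t + j))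
      MeasureTheory.volume 0 1 := by
    refine (IntervalIntegrable.sum _ hlogs).congr fun t _ => ?_
    simp
  have e : ∀ t : ℝ, (1 - t) ^ q * Real.BohrMollerup.logGammaSeq t n
      = ((1 - t) ^ q * t * Real.log n + (1 - t) ^ q * Real.log (n.factorial : ℝ))
        - ∑ j ∈ Finset.range (n + 1), (1 - t) ^ q * Real.log (t + j) := by
    intro t
    rw [Real.BohrMollerup.logGammaSeq, ← Finset.mul_sum]
    ring
  simp only [e]
  rw [intervalIntegral.integral_sub (Continuous.intervalIntegrable (by fun_prop) _ _) hsum,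
    intervalIntegral.integral_add (hlin.intervalIntegrable _ _) (hcst.intervalIntegrable _ _),
    intervalIntegral.integral_mul_const, intervalIntegral.integral_mul_const,
    intervalIntegral.integral_finsetSum hlogs, mul_sub, Finset.mul_sum,
    Finset.sum_congr rfl fun j _ => integral_pow_mul_log_add q (Nat.cast_nonneg j),
    Finset.sum_sub_distrib, sum_pow_succ_mul_log (q + 1) (n + 1),
    ← log_factorial_eq_sum, Finset.sum_comm]
  have hdiv : ∀ i ∈ Finset.range (q + 1), ∑ j ∈ Finset.range (n + 1),
      ((j : ℝ) + 1) ^ i / ((q : ℝ) + 1 - i) = 1 / ((q : ℝ) + 1 - i)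
          * ∑ j ∈ Finset.range (n + 1), ((j : ℝ) + 1) ^ i := by
    intro i _
    rw [Finset.mul_sum]
    exact Finset.sum_congr rfl fun j _ => by ring
  rw [Finset.sum_congr rfl hdiv]
  -- The `log n!` of Euler's sequence cancels the `∑ log j` left by the summation by parts.
  linear_combination Real.log (n.factorial : ℝ) * hone

theorem integral_pow_mul_logGamma (q : ℕ) :
    ((q : ℝ) + 1) * ∫ t in (0 : ℝ)..1, (1 - t) ^ q * logGamma t
      = ∑ k ∈ Finset.range (q + 1),
        ((q + 1).choose k : ℝ) * Real.log (generalizedGlaisher k) := by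
  set c : ℝ := ((q : ℝ) + 1) * ∫ t in (0 : ℝ)..1, (1 - t) ^ q * t with hc
  -- The remainder is taken at `N = n + 1`; the null term `c (log (n + 1) - log n)` in `hlim`
  -- replaces `log n` by `log N`.
  set R : ℕ → ℝ := fun N =>
    (c * ((N : ℝ) ^ 0 * Real.log N) - (N : ℝ) ^ (q + 1) * Real.log N)
    + (∑ k ∈ Finset.range (q + 1), ((q + 1).choose k : ℝ)
      * (glaisherCorrection N k - (N : ℝ) ^ k * Real.log N))
    + ∑ i ∈ Finset.range (q + 1), 1 / ((q : ℝ) + 1 - i)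
      * ∑ j ∈ Finset.range N, ((j : ℝ) + 1) ^ i with hR
  have hpoly : IsPolyLog R :=
    (((((IsPolyLog.pow_mul_log 0).const_mul c).sub (IsPolyLog.pow_mul_log (q + 1)))).add
      (IsPolyLog.sum _ fun k _ => (((isPolyLog_glaisherCorrection k).sub
        (IsPolyLog.pow_mul_log k)).const_mul _))).add
      (IsPolyLog.sum _ fun i _ => (IsPolyLog.sum_pow i).const_mul _)
  have hlim : Tendsto (fun n : ℕ =>
      ((q : ℝ) + 1) * (∫ t in (0 : ℝ)..1, (1 - t) ^ q * Real.BohrMollerup.logGammaSeq t n)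
      + c * (Real.log ((n : ℝ) + 1) - Real.log n)
      - ∑ k ∈ Finset.range (q + 1), ((q + 1).choose k : ℝ) * glaisherSeq k (n + 1)) atTop
      (𝓝 (((q : ℝ) + 1) * (∫ t in (0 : ℝ)..1, (1 - t) ^ q * logGamma t) + c * 0
        - ∑ k ∈ Finset.range (q + 1),
          ((q + 1).choose k : ℝ) * Real.log (generalizedGlaisher k))) :=
    (((tendsto_integral_logGammaSeq q).const_mul _).add
      (tendsto_log_succ_sub_log.const_mul c)).sub
      (tendsto_finsetSum _ fun k _ =>
        ((tendsto_add_atTop_iff_nat 1).2 (tendsto_glaisherSeq k)).const_mul _)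
  have hRlim := (tendsto_add_atTop_iff_nat (f := R) 1).1 (hlim.congr fun n => by
    rw [integral_pow_mul_logGammaSeq]
    simp only [sum_range_pow_mul_log, hR, mul_sub, mul_add, Finset.sum_sub_distrib,
      Finset.sum_add_distrib, ← hc]
    push_cast
    ring)
  have := hpoly.limit_eq_zero hRlim
  linarith

theorem mainTheorem5 (m : ℕ) (hm : 1 ≤ m) :
    -- the limits defining the constants `log D_k` exist
    (∀ k : ℕ, Filter.Tendsto (glaisherSeq k) Filter.atTop
      (nhds (Real.log (generalizedGlaisher k)))) ∧
    -- the integrals involved converge absolutely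
    IntervalIntegrable
      (fun t : ℝ => ((1 - t : ℝ) : ℂ) ^ ((m : ℂ) - 1) * ((logGamma t : ℝ) : ℂ))
      MeasureTheory.volume 0 1 ∧
    (∀ j < m, IntervalIntegrable (repeatedIntegral 0 logGamma j) MeasureTheory.volume 0 1) ∧
    -- the chain of equalities
    leftRiemannLiouville 0 (m : ℂ) logGamma 1 = ((repeatedIntegral 0 logGamma m 1 : ℝ) : ℂ) ∧
    repeatedIntegral 0 logGamma m 1
      = 1 / (m.factorial : ℝ)
        * ∑ k ∈ Finset.range m, (m.choose k : ℝ) * Real.log (generalizedGlaisher k) ∧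
    1 / (m.factorial : ℝ)
        * ∑ k ∈ Finset.range m, (m.choose k : ℝ) * Real.log (generalizedGlaisher k)
      = ∑ k ∈ Finset.range m,
          Real.log (generalizedGlaisher k)
            / ((k.factorial : ℝ) * ((m - k).factorial : ℝ)) := by
  have hcont : ContinuousOn logGamma (Set.Ioo 0 1) :=
    continuousOn_logGamma.mono Set.Ioo_subset_Ioi_self
  refine ⟨tendsto_glaisherSeq, ?_, fun j _ =>
    intervalIntegrable_repeatedIntegral intervalIntegrable_logGamma j, ?_, ?_, ?_⟩
  · simp only [sub_cpow_nat_sub_one hm, ← Complex.ofReal_mul]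
    have h := intervalIntegrable_pow_mul_logGamma (m - 1)
    exact ⟨h.1.ofReal, h.2.ofReal⟩
  · rw [leftRiemannLiouville_natCast hm,
      ← repeatedIntegral_succ_one hcont intervalIntegrable_logGamma, Nat.sub_add_cancel hm]
  · obtain ⟨q, rfl⟩ : ∃ q, m = q + 1 := ⟨m - 1, by omega⟩
    rw [repeatedIntegral_succ_one hcont intervalIntegrable_logGamma, ← integral_pow_mul_logGamma,
      Nat.factorial_succ]
    have : (q : ℝ) + 1 ≠ 0 := by positivity
    have : (q.factorial : ℝ) ≠ 0 := by positivity
    push_cast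
    field_simp
  · rw [Finset.mul_sum]
    refine Finset.sum_congr rfl fun k hk => ?_
    rw [Nat.cast_choose ℝ (Finset.mem_range.1 hk).le]
    have : (m.factorial : ℝ) ≠ 0 := by positivity
    field_simp
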